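/- Conventions. A Turing machine $T$ consists of a finite set of states $Q$ with an initial state $q_0$ and a halting state $q_{halt}$, a finite alphabet $\Sigma$ with at least two symbols (numbered $0,1,\dots$, with $0$ the blank), and a transition function $\delta:Q\times\Sigma\to Q\times\Sigma\times\{-1,0,1\}$. In state $q\ne q_{halt}$ with tape $t=(t_n)_{n\in\mathbb Z}$, one step computes $\delta(q,t_0)=(q',t_0',\varepsilon)$, replaces $q$ by $q'$ and $t_0$ by $t_0'$, and shifts the tape by $\varepsilon$ ($1$ is the left shift, $-1$ the right shift); in state $q_{halt}$ the machine stops and returns its tape. Input tapes have finitely many non-blank symbols and are given by finite words. An *explicit open set* of $\mathbb R^2$ is a set given by a finite list of open rectangles with sides parallel to the axes and rational vertices, each accompanied by a finite list $A_1,\dots,A_r$ of maps $(x,y)\mapsto(\alpha x+\beta,\alpha' y+\beta')$ with rational coefficients and $\alpha,\alpha'>0$: it is the union, over the list of rectangles $R$, of all the sets $A_1^{n_1}\cdots A_r^{n_r}(R)$ with $n_1,\dots,n_r\ge 0$. (Half-planes and periodic arrays of rectangles are of this kind.) A vector field $Y$ on $\mathbb R^2$ is *Turing complete* if there are a computable map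 that assigns to each Turing machine $T$ and input tape $t$ a point $p=p_{T,t}\in\mathbb Q^2$, and a computable map that assigns to each finite string $t^*=(t^*_{-k},\dots,t^*_k)$, $k\ge 0$, an explicit open set $U_{t^*}\subset\mathbb R^2$ (given by its finite description), such that for all $k\ge0$, every $T$, every $t$ and every string $t^*=(t^*_{-k},\dots,t^*_k)$ of symbols of the alphabet of $T$: the trajectory of $Y$ through $p_{T,t}$ for positive times intersects $U_{t^*}$ if and only if $T$ halts on input $t$ with an output tape whose positions $-k,\dots,k$ carry the symbols $t^*_{-k},\dots,t^*_k$. Theorem. There exists a $C^\infty$ function $f:\mathbb R^2\to\mathbb R$ whose gradient $\nabla f$ is Turing complete in a weakly robust way: $\nabla f$ is Turing complete, and there is a $C^\infty$ error function $\epsilon:\mathbb R^2\to(0,1)$ with $\epsilon(x,y)\to0$ as $|(x,y)|\to\infty$, such that every $C^\infty$ vector field $Y$ on $\mathbb R^2$ with $|\nabla f(x,y)-Y(x,y)|\le\epsilon(x,y)$ for all $(x,y)\in\mathbb R^2$ is also Turing complete. -/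

import Mathlib

open Set Filter Topology
open scoped ContDiff

/-! ### Turing machines -/

/-- A Turing machine: finitely many states, a finite alphabet with at least two symbols,
an initial state, a halting state, and a transition function
`δ : Q × Σ → Q × Σ × {-1, 0, 1}`. The symbol `0` of the alphabet is the blank symbol. -/
structure TMachine where
  /-- number of states -/
  numStates : ℕ
  /-- number of symbols -/
  numSymbols : ℕ
  two_le_numSymbols : 2 ≤ numSymbols
  /-- initial state -/
  init : Fin numStates
  /-- halting state -/
  halt : Fin numStates
  /-- transition function; `SignType` is the three-element type `{-1, 0, 1}` -/
  δ : Fin numStates → Fin numSymbols → Fin numStates × Fin numSymbols × SignType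

namespace TMachine

/-- The states `Q`. -/
abbrev State (T : TMachine) : Type := Fin T.numStates

/-- The alphabet `Σ`. -/
abbrev Symbol (T : TMachine) : Type := Fin T.numSymbols

/-- Two-sided infinite tapes. -/
abbrev Tape (T : TMachine) : Type := ℤ → T.Symbol

/-- The blank symbol. -/
def blank (T : TMachine) : T.Symbol := ⟨0, by have := T.two_le_numSymbols; omega⟩

/-- One step of the algorithm on configurations `(q, t)`. Halting configurations are left fixed.
Otherwise, with `δ (q, t₀) = (q', t₀', ε)`, the state becomes `q'`, the symbol at position `0`
becomes `t₀'`, and the tape is shifted by `ε` (`1` is the left shift, `-1` the right shift). -/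
def step (T : TMachine) (c : T.State × T.Tape) : T.State × T.Tape :=
  if c.1 = T.halt then c
  else
    ((T.δ c.1 (c.2 0)).1,
      fun n : ℤ => Function.update c.2 0 (T.δ c.1 (c.2 0)).2.1
        (n + ((T.δ c.1 (c.2 0)).2.2 : ℤ)))

/-- The machine, started in its initial state on the tape `t`, halts and returns the tape `o`. -/
def Outputs (T : TMachine) (t o : T.Tape) : Prop :=
  ∃ l : ℕ, T.step^[l] (T.init, t) = (T.halt, o)

/-- The machine halts on the tape `t` with an output tape whose positions `-k, …, k` carry the
symbols of the string `w`. -/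
def HaltsWith (T : TMachine) (t : T.Tape) (k : ℕ) (w : Fin (2 * k + 1) → T.Symbol) : Prop :=
  ∃ o : T.Tape, T.Outputs t o ∧ ∀ j : Fin (2 * k + 1), o ((j : ℤ) - (k : ℤ)) = w j

/-- The tape `… u₁ u₀ . v₀ v₁ …`, blank outside the two finite words: `v` is written on the
positions `0, 1, 2, …` and `u` on the positions `-1, -2, -3, …`. All tapes with finitely many
non-blank symbols arise in this way. -/
def tapeOf (T : TMachine) (u v : List T.Symbol) : T.Tape := fun n =>
  if 0 ≤ n then v.getD n.toNat T.blank else u.getD (-n - 1).toNat T.blank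

/-- The description of a machine by finitely many integers, used as input of computable
functions: the numbers of states and symbols, the initial and halting states, and the table of the
transition function. -/
def code (T : TMachine) : ℕ × ℕ × ℕ × ℕ × List (List (ℕ × ℕ × ℤ)) :=
  (T.numStates, T.numSymbols, T.init, T.halt,
    List.ofFn fun q : T.State => List.ofFn fun a : T.Symbol =>
      (((T.δ q a).1 : ℕ), ((T.δ q a).2.1 : ℕ), ((T.δ q a).2.2 : ℤ)))

/-- The description of an input (a machine together with an input tape given by two words). -/
def inputCode (T : TMachine) (u v : List T.Symbol) :
    (ℕ × ℕ × ℕ × ℕ × List (List (ℕ × ℕ × ℤ))) × List ℕ × List ℕ :=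
  (T.code, u.map (fun a => (a : ℕ)), v.map (fun a => (a : ℕ)))

/-- The description of a finite string of symbols. -/
def stringCode (T : TMachine) {n : ℕ} (w : Fin n → T.Symbol) : List ℕ :=
  List.ofFn fun j => ((w j : ℕ))

end TMachine

/-! ### Explicit points and explicit open sets of the plane -/

/-- A pair `(a, b)` describes the rational number `a / (b + 1)`. -/
abbrev RatCode : Type := ℤ × ℕ

/-- The number described by a code. -/
noncomputable def RatCode.val (r : RatCode) : ℝ := (r.1 : ℝ) / ((r.2 : ℝ) + 1)

/-- A pair `(a, b)` describes the positive rational number `(a + 1) / (b + 1)`. -/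
abbrev PosRatCode : Type := ℕ × ℕ

/-- The positive number described by a code. -/
noncomputable def PosRatCode.val (r : PosRatCode) : ℝ := ((r.1 : ℝ) + 1) / ((r.2 : ℝ) + 1)

theorem PosRatCode.val_pos (r : PosRatCode) : 0 < PosRatCode.val r := by
  unfold PosRatCode.val; positivity

/-- `((α, β), (α', β'))` describes the axis-parallel affine map
`(x, y) ↦ (α x + β, α' y + β')`, with positive rational `α, α'` and rational `β, β'`. -/
abbrev AxisMapCode : Type := (PosRatCode × RatCode) × (PosRatCode × RatCode)

/-- The affine map described by a code. -/
noncomputable def AxisMapCode.toMap (A : AxisMapCode) : ℝ × ℝ → ℝ × ℝ :=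
  Prod.map (fun x => PosRatCode.val A.1.1 * x + RatCode.val A.1.2)
    (fun y => PosRatCode.val A.2.1 * y + RatCode.val A.2.2)

/-- `((a, b), (c, d))` describes the open rectangle `(a, b) × (c, d)` with rational vertices. -/
abbrev BoxCode : Type := (RatCode × RatCode) × (RatCode × RatCode)

/-- The open rectangle described by a code. -/
noncomputable def BoxCode.toSet (B : BoxCode) : Set (ℝ × ℝ) :=
  Ioo (RatCode.val B.1.1) (RatCode.val B.1.2) ×ˢ Ioo (RatCode.val B.2.1) (RatCode.val B.2.2)

/-- For a list `A₁, …, Aᵣ` of maps, the union of all `A₁^{n₁} ⋯ Aᵣ^{nᵣ} (S)`, `nⱼ ≥ 0`. -/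
noncomputable def progression : List AxisMapCode → Set (ℝ × ℝ) → Set (ℝ × ℝ)
  | [], S => S
  | A :: L, S => ⋃ n : ℕ, (AxisMapCode.toMap A)^[n] '' progression L S

/-- The finite description of an explicit open set: finitely many open rectangles, each of them
with a finite list of affine maps along which it is repeated. -/
abbrev OpenCode : Type := List (BoxCode × List AxisMapCode)

/-- The explicit open set described by a code: the union of the progressions of its rectangles.
Examples: finite unions of rectangles, quadrants, half-planes, periodic arrays
`⋃_{j,k ≥ 0} (a + 2j, b + 2j) × (k - e, k + e)`, and such arrays in which the interval `(a, b)`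
runs moreover through the intervals `ρ^m σ^n (a, b)`, `m, n ≥ 0`. -/
noncomputable def OpenCode.toSet (U : OpenCode) : Set (ℝ × ℝ) :=
  {z | ∃ C ∈ U, z ∈ progression C.2 (BoxCode.toSet C.1)}

theorem AxisMapCode.isOpenMap (A : AxisMapCode) : IsOpenMap (AxisMapCode.toMap A) := by
  have key : ∀ (a : PosRatCode) (b : RatCode),
      IsOpenMap (fun x : ℝ => PosRatCode.val a * x + RatCode.val b) := fun a b =>
    ((Homeomorph.mulLeft₀ _ (PosRatCode.val_pos a).ne').trans
      (Homeomorph.addRight (RatCode.val b))).isOpenMap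
  exact (key _ _).prodMap (key _ _)

theorem isOpen_progression (L : List AxisMapCode) (S : Set (ℝ × ℝ)) (hS : IsOpen S) :
    IsOpen (progression L S) := by
  induction L with
  | nil => exact hS
  | cons A L ih =>
    refine isOpen_iUnion fun n => ?_
    have h : IsOpenMap (AxisMapCode.toMap A)^[n] := by
      induction n with
      | zero => exact IsOpenMap.id
      | succ n ihn => exact ihn.comp (AxisMapCode.isOpenMap A)
    exact h _ ih

/-- Explicit open sets are open. -/
theorem OpenCode.isOpen (U : OpenCode) : IsOpen (OpenCode.toSet U) := by
  have h : OpenCode.toSet U = ⋃ C ∈ U, progression C.2 (BoxCode.toSet C.1) := by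
    ext z; simp [OpenCode.toSet]
  rw [h]
  exact isOpen_biUnion fun C _ =>
    isOpen_progression _ _ (isOpen_Ioo.prod isOpen_Ioo)

/-! ### Turing complete vector fields on the plane -/

/-- The Euclidean plane. -/
abbrev Plane : Type := EuclideanSpace ℝ (Fin 2)

/-- The point of the plane with the rational coordinates described by `z`. -/
noncomputable def ratPoint (z : RatCode × RatCode) : Plane :=
  !₂[RatCode.val z.1, RatCode.val z.2]

/-- The forward trajectory of the vector field `Y` through `p` meets `U`: some integral curve
`γ : [0, b] → ℝ²` of `Y` starts at `p` and ends in `U`. The field need not be complete. -/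
def TrajectoryMeets (Y : Plane → Plane) (p : Plane) (U : Set (ℝ × ℝ)) : Prop :=
  ∃ (b : ℝ) (γ : ℝ → Plane), 0 ≤ b ∧ γ 0 = p ∧
    (∀ t ∈ Icc 0 b, HasDerivWithinAt γ (Y (γ t)) (Icc 0 b) t) ∧ (γ b 0, γ b 1) ∈ U

/-- The vector field `Y` is Turing complete. The point `p` is computed from the machine and the
input tape, and the open set `U` is computed from the finite string; both computations always
terminate and return finite exact descriptions. -/
def IsTuringComplete (Y : Plane → Plane) : Prop :=
  ∃ (p : (ℕ × ℕ × ℕ × ℕ × List (List (ℕ × ℕ × ℤ))) × List ℕ × List ℕ → RatCode × RatCode)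
    (U : List ℕ → OpenCode), Computable p ∧ Computable U ∧
    ∀ (k : ℕ) (T : TMachine) (u v : List T.Symbol) (w : Fin (2 * k + 1) → T.Symbol),
      TrajectoryMeets Y (ratPoint (p (T.inputCode u v))) (OpenCode.toSet (U (T.stringCode w))) ↔
        T.HaltsWith (T.tapeOf u v) k w

/-- The vector field `X` is Turing complete in a weakly robust way: it is Turing complete, and
there is a smooth error function `ε : ℝ² → (0, 1)`, tending to zero at infinity, such that every
smooth vector field `Y` with `|X - Y| ≤ ε` pointwise is Turing complete as well. -/
def IsWeaklyRobustTuringComplete (X : Plane → Plane) : Prop :=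
  IsTuringComplete X ∧
    ∃ ε : Plane → ℝ, ContDiff ℝ ∞ ε ∧ (∀ z, 0 < ε z ∧ ε z < 1) ∧
      Tendsto ε (cocompact Plane) (𝓝 0) ∧
      ∀ Y : Plane → Plane, ContDiff ℝ ∞ Y → (∀ z, ‖X z - Y z‖ ≤ ε z) → IsTuringComplete Y

/-!
The potential has the form `f = x - (y - n - g n (x))² / (2 δ)` near the horizontal line `y = n`,
where the profile `g n` is a flat function with a bump of height `3 δ` over certain positive
integers `i`. Since `|g n'| ≤ 1/2`, the gradient of `f` has a definite positive `x`-component in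
the tube of radius `δ` around the graph of `n + g n`, and on the boundary of the tube it points
inwards, by an amount that does not depend on `n` or `x`. Both facts survive any perturbation of
size `1/10` (`FollowsProfile.mem_tube`, `FollowsProfile.quarter_le_fst`), so that for every field
near the gradient the curve starting at `(0, n)` runs through the tube to the right, and it exists
until it passes any given abscissa (`FollowsProfile.exists_reach`). An error function that tends
to zero at infinity is more than is needed.

The bumps are the output device. The row `n` stands for a machine with an input, and the column
`i = 2 ^ m * (2 a + 1)` for the string number `m` and the time `i`; there is a bump at `(n, i)` if
and only if the machine halts within `i` steps with an output carrying that string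
(`TMachine.Signal`). Row by row the potential thus records the successive results of running the
machine. The rectangles around the tops of all possible bumps in the columns of the string number
`m` form a doubly periodic array, hence an explicit open set computable from `m`
(`windowCode`, `mem_windowCode`), and the curve of the row `n` meets it exactly if it climbs one of
these bumps (`FollowsProfile.trajectoryMeets_windowCode_iff`). Starting points and open sets do
not depend on the perturbation.
-/

/-! ### Gluing smooth functions along unit cells -/

/-- The function that agrees with `φ j` on the cell of all points whose `l`-value is nearest to
the integer `j`. -/
noncomputable def cellGlue {E : Type*} (l : E → ℝ) (φ : ℤ → E → ℝ) (z : E) : ℝ :=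
  φ (round (l z)) z

/-- The glued function agrees with `φ j` beyond the cell of `j`: on the overlap with the
neighbouring cells all the functions involved vanish. -/
theorem cellGlue_eq {E : Type*} {l : E → ℝ} {φ : ℤ → E → ℝ}
    (h0 : ∀ (j : ℤ) (z : E), 1 / 3 ≤ |l z - j| → φ j z = 0) {j : ℤ} {z : E} (h : |l z - j| < 2 / 3) :
    cellGlue l φ z = φ j z := by
  unfold cellGlue
  by_cases hj : round (l z) = j
  · rw [hj]
  have h1 : |l z - round (l z)| ≤ 1 / 2 := abs_sub_round _
  have h2 : (1 : ℝ) ≤ |(round (l z) : ℝ) - j| := by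
    have : 1 ≤ |round (l z) - j| := Int.one_le_abs (sub_ne_zero.2 hj)
    exact_mod_cast this
  have h3 : |(round (l z) : ℝ) - j| ≤ |l z - round (l z)| + |l z - j| := by
    rw [abs_sub_comm (l z) (round (l z) : ℝ)]
    exact abs_sub_le _ _ _
  rw [h0 _ z (by linarith), h0 _ z (by linarith)]

theorem contDiff_cellGlue {E : Type*} [NormedAddCommGroup E] [NormedSpace ℝ E] {l : E → ℝ}
    {φ : ℤ → E → ℝ} (hl : Continuous l) (hφ : ∀ j, ContDiff ℝ ∞ (φ j))
    (h0 : ∀ (j : ℤ) (z : E), 1 / 3 ≤ |l z - j| → φ j z = 0) : ContDiff ℝ ∞ (cellGlue l φ) := by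
  rw [contDiff_iff_contDiffAt]
  intro z
  refine (hφ (round (l z))).contDiffAt.congr_of_eventuallyEq ?_
  have hopen : IsOpen {w | |l w - round (l z)| < 2 / 3} :=
    isOpen_lt ((hl.sub continuous_const).abs) continuous_const
  filter_upwards [hopen.mem_nhds (show |l z - round (l z)| < 2 / 3 by
    have := abs_sub_round (l z); linarith)] with w hw
  exact cellGlue_eq h0 hw

/-! ### The profile curves -/

/-- A smooth bump on the line, equal to `1` on `[-1/6, 1/6]` and to `0` off `(-1/3, 1/3)`. -/
noncomputable def plateau : ContDiffBump (0 : ℝ) :=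
  ⟨1 / 6, 1 / 3, by norm_num, by norm_num⟩

theorem plateau_eq_zero {x : ℝ} (h : 1 / 3 ≤ |x|) : plateau x = 0 :=
  plateau.zero_of_le_dist (by simpa [plateau, Real.dist_eq] using h)

theorem plateau_eq_one {x : ℝ} (h : |x| ≤ 1 / 6) : plateau x = 1 :=
  plateau.one_of_mem_closedBall (by simpa [plateau, Real.dist_eq] using h)

theorem exists_bound_deriv_plateau : ∃ M : ℝ, ∀ x, |deriv plateau x| ≤ M :=
  plateau.hasCompactSupport.deriv.exists_bound_of_continuous
    ((plateau.contDiff (n := 1)).continuous_deriv le_rfl)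

open Classical in
/-- The height of the bump at the integer `i`: `3 δ` if `i` is marked, and `0` otherwise. -/
noncomputable def bumpHeight (b : ℤ → Prop) (δ : ℝ) (i : ℤ) : ℝ := if b i then 3 * δ else 0

/-- The function whose graph runs along level `0`, with a bump of height `3 δ` over every
integer marked by `b`. -/
noncomputable def profile (b : ℤ → Prop) (δ : ℝ) : ℝ → ℝ :=
  cellGlue id fun i x => bumpHeight b δ i * plateau (x - i)

theorem profile_cell_vanish (b : ℤ → Prop) (δ : ℝ) (i : ℤ) (x : ℝ) (h : 1 / 3 ≤ |id x - (i : ℝ)|) :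
    bumpHeight b δ i * plateau (x - i) = 0 := by
  rw [plateau_eq_zero (x := x - i) h, mul_zero]

theorem contDiff_profile (b : ℤ → Prop) (δ : ℝ) : ContDiff ℝ ∞ (profile b δ) :=
  contDiff_cellGlue continuous_id
    (fun _ => contDiff_const.mul (plateau.contDiff.comp (contDiff_id.sub contDiff_const)))
    (profile_cell_vanish b δ)

theorem profile_eq {b : ℤ → Prop} {δ : ℝ} {i : ℤ} {x : ℝ} (h : |x - i| < 2 / 3) :
    profile b δ x = bumpHeight b δ i * plateau (x - i) :=
  cellGlue_eq (profile_cell_vanish b δ) h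

theorem profile_intCast (b : ℤ → Prop) (δ : ℝ) (i : ℤ) : profile b δ i = bumpHeight b δ i := by
  rw [profile_eq (i := i) (by norm_num), plateau_eq_one (by norm_num), mul_one]

theorem bumpHeight_nonneg (b : ℤ → Prop) {δ : ℝ} (hδ : 0 ≤ δ) (i : ℤ) : 0 ≤ bumpHeight b δ i := by
  unfold bumpHeight; split_ifs <;> linarith

theorem bumpHeight_le (b : ℤ → Prop) {δ : ℝ} (hδ : 0 ≤ δ) (i : ℤ) :
    bumpHeight b δ i ≤ 3 * δ := by
  unfold bumpHeight; split_ifs <;> linarith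

theorem profile_mem_Icc (b : ℤ → Prop) {δ : ℝ} (hδ : 0 ≤ δ) (x : ℝ) :
    profile b δ x ∈ Icc 0 (3 * δ) := by
  have h := abs_sub_round x
  rw [profile_eq (i := round x) (by linarith)]
  have h1 := bumpHeight_nonneg b hδ (round x)
  have h2 := bumpHeight_le b hδ (round x)
  exact ⟨mul_nonneg h1 plateau.nonneg, (mul_le_of_le_one_right h1 plateau.le_one).trans h2⟩

theorem abs_deriv_profile_le (b : ℤ → Prop) {δ M : ℝ} (hδ : 0 ≤ δ)
    (hM : ∀ x, |deriv plateau x| ≤ M) (hMδ : 3 * δ * M ≤ 1 / 2) (x : ℝ) :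
    |deriv (profile b δ) x| ≤ 1 / 2 := by
  have hx := abs_sub_round x
  have hopen : IsOpen {w : ℝ | |w - round x| < 2 / 3} :=
    isOpen_lt (continuous_id.sub continuous_const).abs continuous_const
  have heq : profile b δ =ᶠ[𝓝 x] fun w => bumpHeight b δ (round x) * plateau (w - round x) := by
    filter_upwards [hopen.mem_nhds (show |x - round x| < 2 / 3 by linarith)] with w hw
    exact profile_eq hw
  have hd : deriv (fun w => bumpHeight b δ (round x) * plateau (w - round x)) x =
      bumpHeight b δ (round x) * deriv plateau (x - round x) := by
    have h1 : HasDerivAt plateau (deriv plateau (x - round x)) (x - round x) :=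
      ((plateau.contDiff (n := 1)).differentiable (by norm_num) _).hasDerivAt
    exact ((h1.comp_sub_const x _).const_mul _).deriv
  rw [heq.deriv_eq, hd, abs_mul, abs_of_nonneg (bumpHeight_nonneg b hδ _)]
  calc bumpHeight b δ (round x) * |deriv plateau (x - round x)|
      ≤ 3 * δ * M := by
        gcongr
        · exact bumpHeight_le b hδ _
        · exact hM _
    _ ≤ 1 / 2 := hMδ

/-! ### The potential -/

/-- In the strip around the level `n` the potential is `x - (y - n - g (x))² / (2 δ)`, where `g`
is the profile of the row `n` of the table `b`; strips of different rows are glued by a cutoff in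
the `y`-direction. -/
noncomputable def potential (b : ℤ → ℤ → Prop) (δ : ℝ) (z : Plane) : ℝ :=
  z 0 - (2 * δ)⁻¹ * cellGlue (fun z : Plane => z 1)
    (fun n z => plateau (z 1 - n) * (z 1 - n - profile (b n) δ (z 0)) ^ 2) z

theorem potential_cell_vanish (b : ℤ → ℤ → Prop) (δ : ℝ) (n : ℤ) (z : Plane)
    (h : 1 / 3 ≤ |z 1 - n|) :
    plateau (z 1 - n) * (z 1 - n - profile (b n) δ (z 0)) ^ 2 = 0 := by
  rw [plateau_eq_zero h, zero_mul]

theorem contDiff_coord (i : Fin 2) : ContDiff ℝ ∞ fun z : Plane => z i :=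
  (EuclideanSpace.proj i : Plane →L[ℝ] ℝ).contDiff

theorem contDiff_potential (b : ℤ → ℤ → Prop) (δ : ℝ) : ContDiff ℝ ∞ (potential b δ) := by
  refine (contDiff_coord 0).sub (contDiff_const.mul (contDiff_cellGlue
    (contDiff_coord 1).continuous (fun n => ?_) (potential_cell_vanish b δ)))
  have h1 : ContDiff ℝ ∞ fun z : Plane => z 1 - n := (contDiff_coord 1).sub contDiff_const
  exact (plateau.contDiff.comp h1).mul
    ((h1.sub ((contDiff_profile (b n) δ).comp (contDiff_coord 0))).pow 2)

theorem gradient_potential {b : ℤ → ℤ → Prop} {δ : ℝ} {n : ℤ} {z : Plane}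
    (hz : |z 1 - n| < 1 / 6) :
    gradient (potential b δ) z 0 =
        1 + δ⁻¹ * (z 1 - n - profile (b n) δ (z 0)) * deriv (profile (b n) δ) (z 0) ∧
      gradient (potential b δ) z 1 = -(δ⁻¹ * (z 1 - n - profile (b n) δ (z 0))) := by
  have hopen : IsOpen {w : Plane | |w 1 - n| < 1 / 6} :=
    isOpen_lt ((contDiff_coord 1).continuous.sub continuous_const).abs continuous_const
  have heq : potential b δ =ᶠ[𝓝 z]
      fun w => w 0 - (2 * δ)⁻¹ * (w 1 - n - profile (b n) δ (w 0)) ^ 2 := by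
    filter_upwards [hopen.mem_nhds hz] with w hw
    have hw : |w 1 - n| < 1 / 6 := hw
    unfold potential
    rw [cellGlue_eq (potential_cell_vanish b δ) (hw.trans (by norm_num)),
      plateau_eq_one hw.le, one_mul]
  have hp : ∀ i : Fin 2, HasFDerivAt (fun w : Plane => w i)
      (EuclideanSpace.proj i : Plane →L[ℝ] ℝ) z :=
    fun i => (EuclideanSpace.proj i : Plane →L[ℝ] ℝ).hasFDerivAt
  have hg : HasDerivAt (profile (b n) δ) (deriv (profile (b n) δ) (z 0)) (z 0) :=
    ((contDiff_profile (b n) δ).differentiable (by simp) _).hasDerivAt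
  have hd := ((hp 0).sub (((((hp 1).sub_const (n : ℝ)).sub
    (hg.comp_hasFDerivAt z (hp 0))).pow 2).const_mul (2 * δ)⁻¹)).congr_of_eventuallyEq heq
  have hcoord : ∀ i, gradient (potential b δ) z i =
      fderiv ℝ (potential b δ) z (EuclideanSpace.single i 1) := by
    intro i
    rw [← inner_gradient_left, EuclideanSpace.inner_single_right]
    simp
  rw [hcoord, hcoord, hd.fderiv]
  constructor
  · simp
    ring
  · simp
    ring

theorem contDiff_gradient_potential (b : ℤ → ℤ → Prop) (δ : ℝ) :
    ContDiff ℝ ∞ fun z => gradient (potential b δ) z :=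
  (InnerProductSpace.toDual ℝ Plane).symm.contDiff.comp
    ((contDiff_potential b δ).fderiv_right (m := ∞) (by norm_cast))

/-! ### Trapping tubes -/

theorem hasDerivWithinAt_coord {γ : ℝ → Plane} {v : Plane} {s : Set ℝ} {t : ℝ}
    (hγ : HasDerivWithinAt γ v s t) (i : Fin 2) : HasDerivWithinAt (fun t => γ t i) (v i) s t :=
  (EuclideanSpace.proj i : Plane →L[ℝ] ℝ).hasFDerivAt.comp_hasDerivWithinAt t hγ

/-- The vector field `Z` is, on the strip `|y - c| ≤ r`, up to an error of `1/10` the gradient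
of `x - (y - c - g (x))² / (2 δ)`, for a function `g` of slope at most `1/2` with values in
`[0, 3 δ]`. The radius `δ` is so small that the tube of this radius around the graph of `c + g`
lies in the strip. -/
structure FollowsProfile (Z : Plane → Plane) (c δ r : ℝ) (g : ℝ → ℝ) : Prop where
  pos : 0 < δ
  le : 4 * δ ≤ r
  width_le : r ≤ 1 / 12
  differentiable : Differentiable ℝ g
  slope : ∀ x, |deriv g x| ≤ 1 / 2
  range : ∀ x, g x ∈ Icc 0 (3 * δ)
  fst : ∀ z : Plane, |z 1 - c| ≤ r →
    |Z z 0 - (1 + δ⁻¹ * (z 1 - c - g (z 0)) * deriv g (z 0))| ≤ 1 / 10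
  snd : ∀ z : Plane, |z 1 - c| ≤ r → |Z z 1 + δ⁻¹ * (z 1 - c - g (z 0))| ≤ 1 / 10

namespace FollowsProfile

variable {Z : Plane → Plane} {c δ r : ℝ} {g : ℝ → ℝ}

theorem mem_strip (h : FollowsProfile Z c δ r g) {z : Plane} (hz : |z 1 - c - g (z 0)| ≤ δ) :
    |z 1 - c| ≤ r := by
  have h1 := abs_le.1 hz
  have h2 := h.range (z 0)
  have h3 := h.le
  rw [abs_le]
  constructor <;> linarith [h2.1, h2.2, h.pos]

theorem congr {r' : ℝ} (h : FollowsProfile Z c δ r g) (hr' : r' ≤ r) (hδr' : 4 * δ ≤ r')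
    {Y : Plane → Plane} (hY : ∀ z : Plane, |z 1 - c| ≤ r' → Y z = Z z) :
    FollowsProfile Y c δ r' g where
  __ := h
  le := hδr'
  width_le := hr'.trans h.width_le
  fst z hz := by rw [hY z hz]; exact h.fst z (hz.trans hr')
  snd z hz := by rw [hY z hz]; exact h.snd z (hz.trans hr')

/-- An integral curve that starts on the curve `y = c + g (x)` stays in the tube of radius `δ`
around it. Where the offset `y - c - g (x)` equals `±δ`, its derivative along the curve is, up to
an error of `3/20`, the number `∓1 - g' ∓ g'²`, which has the sign of its first term and absolute
value at least `3/4`; so the field points into the tube. -/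
theorem mem_tube (h : FollowsProfile Z c δ r g) {γ : ℝ → Plane} {T : ℝ}
    (hγ : ∀ t ∈ Icc 0 T, HasDerivWithinAt γ (Z (γ t)) (Icc 0 T) t)
    (h0 : γ 0 1 - c - g (γ 0 0) = 0) {t : ℝ} (ht : t ∈ Icc 0 T) :
    |γ t 1 - c - g (γ t 0)| ≤ δ := by
  have hδ := h.pos
  have hd : ∀ t ∈ Icc 0 T, HasDerivWithinAt (fun t => γ t 1 - c - g (γ t 0))
      (Z (γ t) 1 - deriv g (γ t 0) * Z (γ t) 0) (Icc 0 T) t := fun t ht =>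
    ((hasDerivWithinAt_coord (hγ t ht) 1).sub_const c).sub
      ((h.differentiable _).hasDerivAt.comp_hasDerivWithinAt t
        (hasDerivWithinAt_coord (hγ t ht) 0))
  have hcont : ContinuousOn (fun t => γ t 1 - c - g (γ t 0)) (Icc 0 T) :=
    fun t ht => (hd t ht).continuousWithinAt
  have hright : ∀ t ∈ Ico 0 T, HasDerivWithinAt (fun t => γ t 1 - c - g (γ t 0))
      (Z (γ t) 1 - deriv g (γ t 0) * Z (γ t) 0) (Ici t) t := fun t ht =>
    ((hd t ⟨ht.1, ht.2.le⟩).mono (Icc_subset_Icc_left ht.1)).mono_of_mem_nhdsWithin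
      (Icc_mem_nhdsGE ht.2)
  have hK : δ⁻¹ * δ = 1 := inv_mul_cancel₀ hδ.ne'
  rw [abs_le]
  constructor
  · have := image_le_of_deriv_right_lt_deriv_boundary' (B := fun _ => δ) (B' := fun _ => 0)
      hcont.neg (fun t ht => (hright t ht).neg) (by simp [h0, hδ.le]) continuousOn_const
      (fun t _ => hasDerivWithinAt_const _ _ _) (fun t ht he => ?_) ht
    · have : -(γ t 1 - c - g (γ t 0)) ≤ δ := this
      linarith
    · have he : γ t 1 - c - g (γ t 0) = -δ := by
        have : -(γ t 1 - c - g (γ t 0)) = δ := he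
        linarith
      have hs := h.mem_strip (z := γ t) (by rw [he, abs_neg, abs_of_pos hδ])
      have h1 := abs_le.1 (h.fst _ hs)
      have h2 := abs_le.1 (h.snd _ hs)
      have h3 := abs_le.1 (h.slope (γ t 0))
      rw [he, mul_neg, hK] at h1 h2
      show -(Z (γ t) 1 - deriv g (γ t 0) * Z (γ t) 0) < 0
      nlinarith [h1.1, h1.2, h2.1, h2.2, h3.1, h3.2]
  · have := image_le_of_deriv_right_lt_deriv_boundary' (B := fun _ => δ) (B' := fun _ => 0)
      hcont hright (by simp [h0, hδ.le]) continuousOn_const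
      (fun t _ => hasDerivWithinAt_const _ _ _) (fun t ht he => ?_) ht
    · exact this
    · have he : γ t 1 - c - g (γ t 0) = δ := he
      have hs := h.mem_strip (z := γ t) (by rw [he, abs_of_pos hδ])
      have h1 := abs_le.1 (h.fst _ hs)
      have h2 := abs_le.1 (h.snd _ hs)
      have h3 := abs_le.1 (h.slope (γ t 0))
      rw [he, hK] at h1 h2
      show Z (γ t) 1 - deriv g (γ t 0) * Z (γ t) 0 < 0
      nlinarith [h1.1, h1.2, h2.1, h2.2, h3.1, h3.2]

/-- Inside the tube the field moves to the right with speed at least `1/4`. -/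
theorem quarter_le_fst (h : FollowsProfile Z c δ r g) {z : Plane}
    (hz : |z 1 - c - g (z 0)| ≤ δ) : 1 / 4 ≤ Z z 0 := by
  have h1 := (abs_le.1 (h.fst z (h.mem_strip hz))).1
  have h2 : |δ⁻¹ * (z 1 - c - g (z 0)) * deriv g (z 0)| ≤ 1 * (1 / 2) := by
    rw [abs_mul, abs_mul, abs_of_pos (inv_pos.2 h.pos)]
    refine mul_le_mul ?_ (h.slope _) (abs_nonneg _) zero_le_one
    rw [inv_mul_le_iff₀ h.pos]
    linarith
  have h3 := (abs_le.1 h2).1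
  linarith

theorem norm_le (h : FollowsProfile Z c δ r g) {z : Plane} (hz : |z 1 - c| ≤ r) :
    ‖Z z‖ ≤ 2 + 2 * δ⁻¹ := by
  have hi : 0 < δ⁻¹ := inv_pos.2 h.pos
  have hh : |z 1 - c - g (z 0)| ≤ 1 := by
    have h1 := abs_le.1 hz
    have h2 := h.range (z 0)
    have h3 := h.le
    have h4 := h.width_le
    rw [abs_le]
    constructor <;> linarith [h2.1, h2.2, h.pos]
  have hA : |δ⁻¹ * (z 1 - c - g (z 0))| ≤ δ⁻¹ := by
    rw [abs_mul, abs_of_pos hi]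
    exact mul_le_of_le_one_right hi.le hh
  have hB : |δ⁻¹ * (z 1 - c - g (z 0)) * deriv g (z 0)| ≤ δ⁻¹ * (1 / 2) := by
    rw [abs_mul]
    exact mul_le_mul hA (h.slope _) (abs_nonneg _) hi.le
  have h1 := abs_le.1 (h.fst z hz)
  have h2 := abs_le.1 (h.snd z hz)
  have h3 := abs_le.1 hA
  have h4 := abs_le.1 hB
  have e0 : |Z z 0| ≤ 11 / 10 + δ⁻¹ * (1 / 2) := by
    rw [abs_le]; constructor <;> linarith
  have e1 : |Z z 1| ≤ 1 / 10 + δ⁻¹ := by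
    rw [abs_le]; constructor <;> linarith
  rw [EuclideanSpace.norm_eq, Fin.sum_univ_two, Real.norm_eq_abs, Real.norm_eq_abs]
  refine Real.sqrt_le_iff.2 ⟨by positivity, ?_⟩
  nlinarith [abs_nonneg (Z z 0), abs_nonneg (Z z 1)]

theorem quarter_mul_le (h : FollowsProfile Z c δ r g) {γ : ℝ → Plane} {T : ℝ} (hT : 0 ≤ T)
    (hγ : ∀ t ∈ Icc 0 T, HasDerivWithinAt γ (Z (γ t)) (Icc 0 T) t)
    (h0 : γ 0 1 - c - g (γ 0 0) = 0) : γ 0 0 + T / 4 ≤ γ T 0 := by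
  have hd : ∀ t ∈ Icc 0 T, HasDerivWithinAt (fun t => γ t 0) (Z (γ t) 0) (Icc 0 T) t :=
    fun t ht => hasDerivWithinAt_coord (hγ t ht) 0
  have hmvt := (convex_Icc (0 : ℝ) T).mul_sub_le_image_sub_of_le_deriv
    (f := fun t => γ t 0) (C := 1 / 4) (fun t ht => (hd t ht).continuousWithinAt)
    (fun t ht => ((hd t (interior_subset ht)).mono interior_subset).differentiableWithinAt)
    (fun t ht => by
      have hI : Icc 0 T ∈ 𝓝 t := mem_interior_iff_mem_nhds.1 ht
      rw [((hd t (interior_subset ht)).hasDerivAt hI).deriv]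
      exact h.quarter_le_fst (h.mem_tube hγ h0 (interior_subset ht)))
    0 ⟨le_rfl, hT⟩ T ⟨hT, le_rfl⟩ hT
  linarith

end FollowsProfile

/-- A bounded `C¹` vector field has integral curves on arbitrarily long time intervals. -/
theorem exists_integralCurve_of_bounded {E : Type*} [NormedAddCommGroup E] [NormedSpace ℝ E]
    [FiniteDimensional ℝ E] {Z : E → E} (hZ : ContDiff ℝ 1 Z) {L : NNReal}
    (hL : ∀ z, ‖Z z‖ ≤ L) (p : E) {T : ℝ} (hT : 0 ≤ T) :
    ∃ γ : ℝ → E, γ 0 = p ∧ ∀ t ∈ Icc 0 T, HasDerivWithinAt γ (Z (γ t)) (Icc 0 T) t := by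
  have : ProperSpace E := FiniteDimensional.proper ℝ E
  have : CompleteSpace E := FiniteDimensional.complete ℝ E
  lift T to NNReal using hT
  obtain ⟨K, hK⟩ := hZ.locallyLipschitz.locallyLipschitzOn
    (s := Metric.closedBall p (L * T : NNReal)) |>.exists_lipschitzOnWith_of_compact
    (isCompact_closedBall _ _)
  have hPL : IsPicardLindelof (fun _ => Z) (tmin := 0) (tmax := T) ⟨0, le_rfl, T.2⟩ p
      (L * T) 0 L K :=
    ⟨fun _ _ => hK, fun _ _ => continuousOn_const, fun _ _ z _ => hL z, by simp⟩
  exact hPL.exists_eq_forall_mem_Icc_hasDerivWithinAt₀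

/-- The integral curve of a field following a profile never has to leave the tube, so that it
exists until it reaches any given abscissa to the right of its starting point. -/
theorem FollowsProfile.exists_reach {Y : Plane → Plane} {c δ r : ℝ} {g : ℝ → ℝ}
    (h : FollowsProfile Y c δ r g) (hr : 4 * δ < r) (hY : ContDiff ℝ ∞ Y) {p : Plane}
    (hp : p 1 - c - g (p 0) = 0) {x : ℝ} (hx : p 0 ≤ x) :
    ∃ (T : ℝ) (γ : ℝ → Plane), 0 ≤ T ∧ γ 0 = p ∧
      (∀ t ∈ Icc 0 T, HasDerivWithinAt γ (Y (γ t)) (Icc 0 T) t) ∧ γ T 0 = x := by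
  have hδ := h.pos
  -- Cutting the field off outside the strip makes it bounded, without affecting the curves
  -- that stay in the tube.
  let θ : ContDiffBump (0 : ℝ) := ⟨4 * δ, r, by linarith, hr⟩
  let Z : Plane → Plane := fun z => θ (z 1 - c) • Y z
  have hZY : ∀ z : Plane, |z 1 - c| ≤ 4 * δ → Z z = Y z := fun z hz => by
    have : θ (z 1 - c) = 1 := θ.one_of_mem_closedBall (by simpa [θ, Real.dist_eq] using hz)
    simp [Z, this]
  have hZ : FollowsProfile Z c δ (4 * δ) g := h.congr hr.le le_rfl hZY
  have hZs : ContDiff ℝ ∞ Z :=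
    (θ.contDiff.comp ((contDiff_coord 1).sub contDiff_const)).smul hY
  have hL : (0 : ℝ) ≤ 2 + 2 * δ⁻¹ := by positivity
  have hZb : ∀ z, ‖Z z‖ ≤ (⟨2 + 2 * δ⁻¹, hL⟩ : NNReal) := fun z => by
    change ‖θ (z 1 - c) • Y z‖ ≤ 2 + 2 * δ⁻¹
    rcases le_total |z 1 - c| r with hz | hz
    · rw [norm_smul, Real.norm_eq_abs, abs_of_nonneg θ.nonneg]
      exact (mul_le_of_le_one_left (norm_nonneg _) θ.le_one).trans (h.norm_le hz)
    · have : θ (z 1 - c) = 0 := θ.zero_of_le_dist (by simpa [θ, Real.dist_eq] using hz)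
      rwa [this, zero_smul, norm_zero]
  have hT : 0 ≤ 4 * (x - p 0) := by linarith
  obtain ⟨γ, hγ0, hγ⟩ := exists_integralCurve_of_bounded (hZs.of_le (by norm_cast))
    hZb p hT
  have hγp : γ 0 1 - c - g (γ 0 0) = 0 := by rw [hγ0, hp]
  have hend := hZ.quarter_mul_le hT hγ hγp
  rw [hγ0] at hend
  have hc : ContinuousOn (fun t => γ t 0) (Icc 0 (4 * (x - p 0))) :=
    fun t ht => (hasDerivWithinAt_coord (hγ t ht) 0).continuousWithinAt
  obtain ⟨T, hTm, hTx⟩ := intermediate_value_Icc hT hc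
    (show x ∈ Icc (γ 0 0) (γ (4 * (x - p 0)) 0) by rw [hγ0]; exact ⟨hx, by linarith⟩)
  refine ⟨T, γ, hTm.1, hγ0, fun t ht => ?_, hTx⟩
  have ht' : t ∈ Icc 0 (4 * (x - p 0)) := ⟨ht.1, ht.2.trans hTm.2⟩
  rw [← hZY (γ t) (hZ.mem_strip (hZ.mem_tube hγ hγp ht'))]
  exact (hγ t ht').mono (Icc_subset_Icc_right hTm.2)

/-- Fields close to the gradient of the potential follow the profile in every strip. -/
theorem followsProfile_of_norm_le {b : ℤ → ℤ → Prop} {δ M : ℝ} (hδ : 0 < δ) (hδ' : 4 * δ ≤ 1 / 12)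
    (hM : ∀ x, |deriv plateau x| ≤ M) (hMδ : 3 * δ * M ≤ 1 / 2) {Y : Plane → Plane}
    (hY : ∀ z, ‖gradient (potential b δ) z - Y z‖ ≤ 1 / 10) (n : ℤ) :
    FollowsProfile Y n δ (1 / 12) (profile (b n) δ) where
  pos := hδ
  le := hδ'
  width_le := le_rfl
  differentiable := (contDiff_profile (b n) δ).differentiable (by simp)
  slope := abs_deriv_profile_le (b n) hδ.le hM hMδ
  range := profile_mem_Icc (b n) hδ.le
  fst z hz := by
    rw [← (gradient_potential (b := b) (δ := δ) (hz.trans_lt (by norm_num))).1, abs_sub_comm]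
    exact (PiLp.norm_apply_le (gradient (potential b δ) z - Y z) 0).trans (hY z)
  snd z hz := by
    rw [← neg_neg (δ⁻¹ * _), ← (gradient_potential (hz.trans_lt (by norm_num))).2,
      ← sub_eq_add_neg, abs_sub_comm]
    exact (PiLp.norm_apply_le (gradient (potential b δ) z - Y z) 1).trans (hY z)

/-! ### Codes of machines, inputs and strings -/

namespace TMachine

theorem code_injective : Function.Injective code := by
  rintro ⟨q, s, h2, i, h, d⟩ ⟨q', s', h2', i', h', d'⟩ hc
  simp only [code, Prod.mk.injEq] at hc
  obtain ⟨rfl, rfl, hi, hh, hl⟩ := hc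
  obtain rfl := Fin.ext hi
  obtain rfl := Fin.ext hh
  have hd : d = d' := by
    funext x y
    have h1 := congrFun (List.ofFn_injective (congrFun (List.ofFn_injective hl) x)) y
    simp only [Prod.mk.injEq] at h1
    refine Prod.ext (Fin.ext h1.1) (Prod.ext (Fin.ext h1.2.1) ?_)
    have h3 := h1.2.2
    revert h3
    generalize (d x y).2.2 = α
    generalize (d' x y).2.2 = β
    revert α β
    decide
  rw [hd]

/-- The table realized by the potential. The entry in row `n` and column `i = 2 ^ m * (2 a + 1)`
says that `n` is the number of a machine with an input, `m` the number of a string `w`, and that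
the machine halts within `i` steps with an output carrying `w` on its middle positions. Every
string has thus infinitely many columns, so the bound on the running time loses nothing. -/
def Signal (n i : ℤ) : Prop :=
  ∃ (T : TMachine) (u v : List T.Symbol) (k : ℕ) (w : Fin (2 * k + 1) → T.Symbol) (a l : ℕ)
    (o : T.Tape), n = (Encodable.encode (T.inputCode u v) : ℕ) ∧
    i = ((2 ^ Encodable.encode (T.stringCode w) * (2 * a + 1) : ℕ) : ℤ) ∧ (l : ℤ) ≤ i ∧
    T.step^[l] (T.init, T.tapeOf u v) = (T.halt, o) ∧
    ∀ j : Fin (2 * k + 1), o ((j : ℤ) - (k : ℤ)) = w j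

theorem Signal.pos {n i : ℤ} (h : Signal n i) : 0 < i := by
  obtain ⟨T, u, v, k, w, a, l, o, -, rfl, -⟩ := h
  positivity

theorem two_pow_mul_odd_inj {m m' a a' : ℕ} (h : 2 ^ m * (2 * a + 1) = 2 ^ m' * (2 * a' + 1)) :
    m = m' := by
  have key : ∀ m a : ℕ, padicValNat 2 (2 ^ m * (2 * a + 1)) = m := fun m a => by
    rw [padicValNat.mul (by positivity) (by omega), padicValNat.prime_pow,
      padicValNat.eq_zero_of_not_dvd (by omega), add_zero]
  rw [← key m a, h, key]

theorem haltsWith_of_signal {T : TMachine} {u v : List T.Symbol} {k : ℕ}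
    {w : Fin (2 * k + 1) → T.Symbol} {a : ℕ}
    (h : Signal (Encodable.encode (T.inputCode u v) : ℕ)
      ((2 ^ Encodable.encode (T.stringCode w) * (2 * a + 1) : ℕ) : ℤ)) :
    T.HaltsWith (T.tapeOf u v) k w := by
  obtain ⟨T', u', v', k', w', a', l, o, hn, hi, -, hl, ho⟩ := h
  have hc := Encodable.encode_injective (Nat.cast_injective hn)
  simp only [inputCode, Prod.mk.injEq] at hc
  obtain ⟨hT, hu, hv⟩ := hc
  obtain rfl := code_injective hT
  -- The words are coerced to `List ℕ` through the list monad.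
  simp only [List.map_id', List.bind_eq_flatMap, List.pure_def, ← List.map_eq_flatMap] at hu hv
  obtain rfl := List.map_injective_iff.2 Fin.val_injective hu
  obtain rfl := List.map_injective_iff.2 Fin.val_injective hv
  have hw := Encodable.encode_injective (two_pow_mul_odd_inj (Nat.cast_injective hi))
  have hk : k = k' := by
    have := congrArg List.length hw
    simp only [stringCode, List.length_ofFn] at this
    omega
  subst hk
  have hww : w = w' := funext fun j => Fin.ext (congrFun (List.ofFn_injective hw) j)
  subst hww
  exact ⟨o, ⟨l, hl⟩, ho⟩

theorem HaltsWith.exists_signal {T : TMachine} {u v : List T.Symbol} {k : ℕ}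
    {w : Fin (2 * k + 1) → T.Symbol} (h : T.HaltsWith (T.tapeOf u v) k w) :
    ∃ a : ℕ, Signal (Encodable.encode (T.inputCode u v) : ℕ)
      ((2 ^ Encodable.encode (T.stringCode w) * (2 * a + 1) : ℕ) : ℤ) := by
  obtain ⟨o, ⟨l, hl⟩, ho⟩ := h
  refine ⟨l, T, u, v, k, w, l, l, o, rfl, rfl, ?_, hl, ho⟩
  have : 1 ≤ 2 ^ Encodable.encode (T.stringCode w) := Nat.one_le_two_pow
  exact_mod_cast (show l ≤ 2 ^ Encodable.encode (T.stringCode w) * (2 * l + 1) by nlinarith)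

end TMachine

/-! ### The computable points and open sets -/

theorem primrec_intCast_nat : Primrec fun n : ℕ => (n : ℤ) := by
  refine Primrec.encode_iff.1 ((Primrec.nat_mul.comp (.const 2) .id).of_eq fun n => ?_)
  rfl

theorem primrec_two_pow : Primrec fun n : ℕ => 2 ^ n := by
  refine (Primrec.nat_rec₁ (f := fun _ r => 2 * r) 1
    (Primrec.nat_mul.comp (.const 2) .snd)).of_eq fun n => ?_
  induction n with
  | zero => rfl
  | succ n ih => simp only [pow_succ, ← ih]; ring

/-- The code of the starting point `(0, encode c)`. -/
def startCode {α : Type*} [Encodable α] (c : α) : RatCode × RatCode :=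
  ((0, 0), ((Encodable.encode c : ℕ), 0))

theorem computable_startCode {α : Type*} [Primcodable α] :
    Computable (startCode : α → RatCode × RatCode) :=
  ((Primrec.const ((0, 0) : RatCode)).pair
    ((primrec_intCast_nat.comp Primrec.encode).pair (.const 0))).to_comp

/-- The code of the array of all rectangles `(i - 1/4, i + 1/4) × (n + δ, n + 5 δ)` with
`i = 2 ^ m * (2 a + 1)`, for `a, n ≥ 0`, where `δ = 1 / (d + 1)`. The truncated
subtraction is exact, as `2 ^ m > 0`. -/
def windowCode (d m : ℕ) : OpenCode :=
  [((((((4 * 2 ^ m - 1 : ℕ) : ℤ), 3), (((4 * 2 ^ m + 1 : ℕ) : ℤ), 3)), ((1, d), (5, d))),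
    [(((0, 0), (((2 * 2 ^ m : ℕ) : ℤ), 0)), ((0, 0), (0, 0))),
      (((0, 0), (0, 0)), ((0, 0), (1, 0)))])]

theorem primrec_windowCode (d : ℕ) : Primrec (windowCode d) := by
  have h4 : Primrec fun m : ℕ => 4 * 2 ^ m := Primrec.nat_mul.comp (.const 4) primrec_two_pow
  have h1 : Primrec fun m : ℕ => ((4 * 2 ^ m - 1 : ℕ) : ℤ) :=
    primrec_intCast_nat.comp (Primrec.nat_sub.comp h4 (.const 1))
  have h2 : Primrec fun m : ℕ => ((4 * 2 ^ m + 1 : ℕ) : ℤ) :=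
    primrec_intCast_nat.comp (Primrec.nat_add.comp h4 (.const 1))
  have h3 : Primrec fun m : ℕ => ((2 * 2 ^ m : ℕ) : ℤ) :=
    primrec_intCast_nat.comp (Primrec.nat_mul.comp (.const 2) primrec_two_pow)
  exact Primrec.list_cons.comp
    ((((h1.pair (.const 3)).pair (h2.pair (.const 3))).pair (.const ((1, d), (5, d)))).pair
      (Primrec.list_cons.comp
        (((Primrec.const ((0, 0) : PosRatCode)).pair (h3.pair (.const 0))).pair
          (.const ((0, 0), (0, 0)))) (.const _))) (.const [])

theorem iterate_toMap_translation {A : AxisMapCode} {s t : ℝ}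
    (hA : ∀ z, A.toMap z = (z.1 + s, z.2 + t)) (n : ℕ) (z : ℝ × ℝ) :
    A.toMap^[n] z = (z.1 + n * s, z.2 + n * t) := by
  induction n with
  | zero => simp
  | succ n ih =>
    rw [Function.iterate_succ_apply', ih, hA]
    ext <;> push_cast <;> ring

theorem mem_windowCode (d m : ℕ) (z : ℝ × ℝ) :
    z ∈ (windowCode d m).toSet ↔ ∃ a n : ℕ,
      |z.1 - (2 ^ m * (2 * a + 1) : ℕ)| < 1 / 4 ∧
      z.2 - n ∈ Ioo (1 / ((d : ℝ) + 1)) (5 / ((d : ℝ) + 1)) := by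
  have e1 : ∀ z, AxisMapCode.toMap (((0, 0), (((2 * 2 ^ m : ℕ) : ℤ), 0)), ((0, 0), (0, 0))) z =
      (z.1 + 2 * 2 ^ m, z.2 + 0) := fun z => by
    simp [AxisMapCode.toMap, PosRatCode.val, RatCode.val]
    rfl
  have e2 : ∀ z, AxisMapCode.toMap (((0, 0), (0, 0)), ((0, 0), (1, 0))) z =
      (z.1 + 0, z.2 + 1) := fun z => by
    simp [AxisMapCode.toMap, PosRatCode.val, RatCode.val]
    rfl
  have hpow : 1 ≤ 4 * 2 ^ m := by have := Nat.one_le_two_pow (n := m); omega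
  simp only [OpenCode.toSet, windowCode, List.mem_singleton, exists_eq_left, mem_ofPred_eq,
    progression, mem_iUnion, mem_image, iterate_toMap_translation e1,
    iterate_toMap_translation e2, BoxCode.toSet, mem_prod, mem_Ioo, RatCode.val, Prod.exists,
    Nat.cast_sub hpow, abs_lt]
  push_cast
  constructor
  · rintro ⟨a, _, _, ⟨n, x, y, ⟨⟨hx1, hx2⟩, hy⟩, h⟩, rfl⟩
    obtain ⟨rfl, rfl⟩ := Prod.mk.inj h
    refine ⟨a, n, ⟨?_, ?_⟩, ?_, ?_⟩ <;> dsimp only <;> linarith [hy.1, hy.2]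
  · rintro ⟨a, n, ⟨hx1, hx2⟩, hy1, hy2⟩
    refine ⟨a, z.1 - a * (2 * 2 ^ m), z.2, ⟨n, z.1 - a * (2 * 2 ^ m), z.2 - n,
      ⟨⟨?_, ?_⟩, ?_, ?_⟩, by simp⟩, by simp⟩ <;> linarith

/-! ### Fields near the gradient of the potential are Turing complete -/

/-- The curve started on the level `n` meets the windows of index `m` exactly when one of the
columns `2 ^ m * (2 a + 1)` is marked in the row `n`: over such a column the tube has climbed to
the levels `n + [2 δ, 4 δ]`, and around an unmarked column it stays within `n + [-δ, δ]`, below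
the windows. -/
theorem FollowsProfile.trajectoryMeets_windowCode_iff {Y : Plane → Plane} {b : ℤ → ℤ → Prop}
    {d n m : ℕ} {r : ℝ}
    (h : FollowsProfile Y n (1 / ((d : ℝ) + 1)) r (profile (b n) (1 / ((d : ℝ) + 1))))
    (hr : 4 * (1 / ((d : ℝ) + 1)) < r) (hY : ContDiff ℝ ∞ Y) (hb : ∀ i, b n i → 0 < i)
    {p : Plane} (hp0 : p 0 = 0) (hp1 : p 1 = n) :
    TrajectoryMeets Y p (windowCode d m).toSet ↔
      ∃ a : ℕ, b n ((2 ^ m * (2 * a + 1) : ℕ) : ℤ) := by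
  have hδ := h.pos
  have hr12 := h.width_le
  have h5 : 5 / ((d : ℝ) + 1) = 5 * (1 / ((d : ℝ) + 1)) := by ring
  have hstart : profile (b n) (1 / ((d : ℝ) + 1)) 0 = 0 := by
    have := profile_intCast (b n) (1 / ((d : ℝ) + 1)) 0
    rw [Int.cast_zero] at this
    rw [this, bumpHeight, if_neg fun h0 => lt_irrefl _ (hb 0 h0)]
  have hp : p 1 - n - profile (b n) (1 / ((d : ℝ) + 1)) (p 0) = 0 := by
    rw [hp0, hp1, hstart]; ring
  constructor
  · rintro ⟨T, γ, hT, rfl, hγ, hU⟩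
    obtain ⟨a, n', hx, hy⟩ := (mem_windowCode _ _ _).1 hU
    rw [h5] at hy
    have htube := abs_le.1 (h.mem_tube hγ hp ⟨hT, le_rfl⟩)
    have hrange := h.range (γ T 0)
    dsimp only at hx hy
    -- The tube and the window lie in the same strip.
    have hn : (n' : ℤ) = n := by
      have h1 : ((n' : ℤ) : ℝ) < ((n + 1 : ℤ) : ℝ) := by
        push_cast; linarith [hy.1, hy.2, hrange.1, hrange.2]
      have h2 : ((n : ℤ) : ℝ) < ((n' + 1 : ℤ) : ℝ) := by
        push_cast; linarith [hy.1, hy.2, hrange.1, hrange.2]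
      have h1 := Int.cast_lt.1 h1
      have h2 := Int.cast_lt.1 h2
      omega
    obtain rfl : n' = n := by exact_mod_cast hn
    refine ⟨a, ?_⟩
    by_contra hnb
    have hzero : profile (b n') (1 / ((d : ℝ) + 1)) (γ T 0) = 0 := by
      rw [profile_eq (i := ((2 ^ m * (2 * a + 1) : ℕ) : ℤ)) (by
        rw [Int.cast_natCast]; linarith), bumpHeight, if_neg hnb, zero_mul]
    rw [hzero] at htube
    linarith [hy.1]
  · rintro ⟨a, ha⟩
    obtain ⟨T, γ, hT, hγ0, hγ, hx⟩ := h.exists_reach hr hY hp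
      (x := (((2 ^ m * (2 * a + 1) : ℕ) : ℤ) : ℝ)) (by rw [hp0]; positivity)
    refine ⟨T, γ, hT, hγ0, hγ, (mem_windowCode _ _ _).2 ⟨a, n, ?_, ?_⟩⟩
    · simp only [hx, Int.cast_natCast, sub_self, abs_zero]
      norm_num
    · have htube := abs_le.1 (h.mem_tube hγ (by rwa [hγ0]) ⟨hT, le_rfl⟩)
      rw [hx, profile_intCast, bumpHeight, if_pos ha] at htube
      rw [h5]
      exact ⟨by linarith [htube.1], by linarith [htube.2]⟩

/-- The lower bounds on `d` make the tube of radius `1 / (d + 1)` thin compared to the strip, and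
the slope of the profiles at most `1/2`. -/
theorem isTuringComplete_of_norm_le {d : ℕ} {M : ℝ} (hd : 48 ≤ d)
    (hM : ∀ x, |deriv plateau x| ≤ M) (hMd : 6 * M ≤ d) {Y : Plane → Plane}
    (hY : ContDiff ℝ ∞ Y)
    (hYf : ∀ z, ‖gradient (potential TMachine.Signal (1 / ((d : ℝ) + 1))) z - Y z‖ ≤ 1 / 10) :
    IsTuringComplete Y := by
  have hd' : (48 : ℝ) ≤ d := by exact_mod_cast hd
  have hδ : 0 < 1 / ((d : ℝ) + 1) := by positivity
  have hδ' : 4 * (1 / ((d : ℝ) + 1)) < 1 / 12 := by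
    rw [mul_one_div, div_lt_div_iff₀ (by positivity) (by norm_num)]
    linarith
  have hMδ : 3 * (1 / ((d : ℝ) + 1)) * M ≤ 1 / 2 := by
    rw [mul_one_div, div_mul_eq_mul_div, div_le_div_iff₀ (by positivity) (by norm_num)]
    linarith
  refine ⟨startCode, fun w => windowCode d (Encodable.encode w), computable_startCode,
    ((primrec_windowCode d).comp Primrec.encode).to_comp, fun k T u v w => ?_⟩
  rw [(followsProfile_of_norm_le hδ hδ'.le hM hMδ hYf
    ((Encodable.encode (T.inputCode u v) : ℕ) : ℤ)).trajectoryMeets_windowCode_iff hδ' hY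
    (fun _ => TMachine.Signal.pos) (by simp [ratPoint, startCode, RatCode.val])
    (by simp [ratPoint, startCode, RatCode.val])]
  exact ⟨fun ⟨_, ha⟩ => TMachine.haltsWith_of_signal ha, fun h => h.exists_signal⟩

theorem theorem4p1 :
    ∃ f : Plane → ℝ, ContDiff ℝ ∞ f ∧ IsWeaklyRobustTuringComplete (fun z => gradient f z) := by
  obtain ⟨M, hM⟩ := exists_bound_deriv_plateau
  obtain ⟨d, hd⟩ := exists_nat_ge (max 48 (6 * M))
  have hd48 : 48 ≤ d := by exact_mod_cast (le_max_left _ _).trans hd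
  have hMd : 6 * M ≤ d := (le_max_right _ _).trans hd
  refine ⟨potential TMachine.Signal (1 / ((d : ℝ) + 1)), contDiff_potential _ _,
    isTuringComplete_of_norm_le hd48 hM hMd (contDiff_gradient_potential _ _) (by simp),
    fun z => (10 * (1 + ‖z‖ ^ 2))⁻¹, ?_, fun z => ⟨by positivity, ?_⟩, ?_, fun Y hY hYf => ?_⟩
  · exact (contDiff_const.mul (contDiff_const.add (contDiff_norm_sq ℝ))).inv
      fun z => by positivity
  · exact inv_lt_one_of_one_lt₀ (by nlinarith [sq_nonneg ‖z‖])
  · refine tendsto_inv_atTop_zero.comp (Tendsto.const_mul_atTop (by norm_num)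
      (tendsto_atTop_add_const_left _ _ ?_))
    exact (tendsto_pow_atTop two_ne_zero).comp (tendsto_norm_cocompact_atTop (E := Plane))
  · refine isTuringComplete_of_norm_le hd48 hM hMd hY fun z => (hYf z).trans ?_
    rw [inv_le_comm₀ (by positivity) (by norm_num)]
    nlinarith [sq_nonneg ‖z‖]
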